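/- Let $\mathfrak c=2^{\aleph_0}$ and $I=[0,1]$. A subalgebra $A$ of a Boolean algebra $B$ is called $\aleph_0$-ideal if for each $b\in B\setminus A$ the ideal $\{a\in A: a<b\}$ of $A$ has a countable cofinal subset. A Boolean algebra $B$ is called $(\aleph_1,\aleph_0)$-ideal if there is a family $\mathcal A$ of $\aleph_0$-ideal subalgebras of $B$, each of cardinality $\aleph_1$, such that every subset of $B$ of cardinality $\aleph_1$ is contained in some member of $\mathcal A$, and the union of every chain (with respect to inclusion) of members of $\mathcal A$ of cofinality $\omega_1$ is again a member of $\mathcal A$. **Theorem.** Assume that the power set algebra $\mathcal P(\omega)$ is $(\aleph_1,\aleph_0)$-ideal and that $2^{\aleph_1}=\mathfrak c=\aleph_2$. If $X$ is a compact Hausdorff separable space of cardinality greater than $\mathfrak c$, then $X$ maps continuously onto $I^{\mathfrak c}$. -/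

import Mathlib

open Cardinal

/-- A subalgebra `A` of a Boolean algebra `B` is `ℵ₀`-ideal if for each `b ∈ B \ A` the ideal
`{a ∈ A : a < b}` of `A` has a countable cofinal subset. -/
def IsAleph0Ideal {B : Type*} [BooleanAlgebra B] (A : BooleanSubalgebra B) : Prop :=
  ∀ b : B, b ∉ A →
    ∃ C : Set B, C ⊆ {a | a ∈ A ∧ a < b} ∧ C.Countable ∧
      ∀ a ∈ A, a < b → ∃ c ∈ C, a ≤ c

/-- A Boolean algebra `B` is `(ℵ₁, ℵ₀)`-ideal if there is a family of `ℵ₁`-sized `ℵ₀`-ideal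
subalgebras of `B` such that every subset of `B` of size `ℵ₁` is contained in some member of the
family, and the union of each chain from the family of cofinality `ω₁` is again in the family.
Subalgebras are ordered by inclusion. -/
def IsAleph1Aleph0Ideal (B : Type*) [BooleanAlgebra B] : Prop :=
  ∃ 𝒜 : Set (BooleanSubalgebra B),
    (∀ A ∈ 𝒜, #A = ℵ₁ ∧ IsAleph0Ideal A) ∧
    (∀ S : Set B, #S = ℵ₁ → ∃ A ∈ 𝒜, S ⊆ (A : Set B)) ∧
    (∀ 𝒞 : Set (BooleanSubalgebra B), 𝒞 ⊆ 𝒜 → IsChain (· ≤ ·) 𝒞 → Order.cof 𝒞 = ℵ₁ →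
      ∃ D ∈ 𝒜, (D : Set B) = ⋃ A ∈ 𝒞, (A : Set B))

/-!
Fix a sequence `d : ℕ → X` with dense range and a family `𝒜` witnessing that the power set of `ℕ`
is `(ℵ₁, ℵ₀)`-ideal.

*A point of large character.* For each `x` choose an ultrafilter `p` on `ℕ` along which `d` tends
to `x`. If the trace of `p` on some `A ∈ 𝒜` already forces convergence to `x`, then `x` is determined
by `A` and this trace. There are at most `𝔠 * 2 ^ ℵ₁ = 𝔠` such pairs, so some `x` is not determined
by any `A ∈ 𝒜` (`exists_tendsto_forall_not_determined`). For this `x` and each `A ∈ 𝒜` there are an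
ultrafilter `q` extending the trace of `p` on `A` and a continuous `g : X → ℝ` such that
`b₁ = {n | 2/3 ≤ g (d n)} ∈ p` and `b₀ = {n | g (d n) ≤ 1/3} ∈ q`.

*Countable control.* Neither `b₀` nor `b₁` lies in `A`, so the ideals of those `a ∈ A` that are
disjoint from `b₀`, respectively from `b₁`, have countable cofinal subsets, and none of their
elements belongs to `p` (`IsAleph0Ideal.exists_countable_cofinal`). Closure of `𝒜` under chains of
cofinality `ω₁` yields one `D ∈ 𝒜` such that arbitrarily large `A ∈ 𝒜` have these countable sets
inside `D` (`exists_mem_forall_exists_subset`); this takes the place of the pressing-down lemma.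

*Independence.* A recursion of length `ω₂` produces such algebras `A w ⊇ D`, each containing the sets
`b₀`, `b₁` of all earlier ones. By induction, every finite intersection of these sets meets every
member of `D` that belongs to `p` (`nonempty_inter_biInter`). So the functions `g` form a dyadic
family of size `ℵ₂ = 𝔠`, which maps a closed subset of `X` onto the Cantor cube `2 ^ 𝔠`, hence onto
`I ^ 𝔠`, and Tietze's theorem extends the map to `X` (`exists_continuous_surjective_of_dyadic`).
-/

open Set Filter Topology

universe u

/-! ### Transfinite recursion with small histories -/

/-- Transfinite recursion in which the choice at stage `w` depends only on the union of the sets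
`G (F v)` attached to the earlier stages `v`. -/
theorem exists_forall_rel_iUnion {W B T : Type u} [LinearOrder W] [WellFoundedLT W]
    (hW : ∀ w : W, #(Iio w) ≤ ℵ₁) (G : T → Set B) (hG : ∀ t, #(G t) ≤ ℵ₁)
    (R : Set B → T → Prop) (hR : ∀ E : Set B, #E ≤ ℵ₁ → ∃ t, R E t) :
    ∃ F : W → T, ∀ w, R (⋃ v : Iio w, G (F v)) (F w) := by
  classical
  obtain ⟨t₀, -⟩ := hR ∅ (by simp)
  let step : Set B → T := fun E ↦ if h : #E ≤ ℵ₁ then (hR E h).choose else t₀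
  let F : W → T := WellFoundedLT.fix fun w F ↦ step (⋃ v : Iio w, G (F v.1 v.2))
  have hF : ∀ w, F w = step (⋃ v : Iio w, G (F v)) := fun w ↦ WellFoundedLT.fix_eq _ w
  refine ⟨F, fun w ↦ ?_⟩
  have hle : #(⋃ v : Iio w, G (F v) : Set B) ≤ ℵ₁ := by
    refine (mk_iUnion_le _).trans ?_
    refine (mul_le_mul' (hW w) (ciSup_le' fun v ↦ hG _)).trans ?_
    rw [mul_eq_self (aleph0_le_aleph 1)]
  generalize hE : (⋃ v : Iio w, G (F v)) = E at hle
  rw [hF w, hE]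
  simp only [step, dif_pos hle]
  exact (hR E hle).choose_spec

/-! ### Ideal subalgebras -/

/-- A covering family for the sets of size `ℵ₁` also covers the smaller sets. -/
theorem exists_mem_subset_of_card_le {B : Type*} [BooleanAlgebra B] (hB : ℵ₁ < #B)
    {𝒜 : Set (BooleanSubalgebra B)}
    (hcov : ∀ S : Set B, #S = ℵ₁ → ∃ A ∈ 𝒜, S ⊆ (A : Set B)) (E : Set B) (hE : #E ≤ ℵ₁) :
    ∃ A ∈ 𝒜, E ⊆ (A : Set B) := by
  obtain ⟨T, hT⟩ := le_mk_iff_exists_set.1 hB.le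
  obtain ⟨A, hA, hs⟩ := hcov (E ∪ T) (le_antisymm
    ((mk_union_le _ _).trans (by rw [hT]; exact add_le_of_le (aleph0_le_aleph 1) hE le_rfl))
    (hT ▸ mk_le_mk_of_subset subset_union_right))
  exact ⟨A, hA, subset_union_left.trans hs⟩

/-- If each member `A` of the family carries a countable subset `C A`, then for one member `D` the
algebras `A` with `C A ⊆ D` are cofinal among the sets of size at most `ℵ₁`. Otherwise a strictly
increasing `ω₁`-chain whose later members contain a counterexample to each earlier one would have
a union `A` in the family, with `C A` inside some member of the chain. -/
theorem exists_mem_forall_exists_subset {B : Type u} [BooleanAlgebra B] (hB : ℵ₁ < #B)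
    {𝒜 : Set (BooleanSubalgebra B)} (hcard : ∀ A ∈ 𝒜, #A = ℵ₁)
    (hcov : ∀ S : Set B, #S = ℵ₁ → ∃ A ∈ 𝒜, S ⊆ (A : Set B))
    (hchain : ∀ 𝒞 : Set (BooleanSubalgebra B), 𝒞 ⊆ 𝒜 → IsChain (· ≤ ·) 𝒞 → Order.cof 𝒞 = ℵ₁ →
      ∃ D ∈ 𝒜, (D : Set B) = ⋃ A ∈ 𝒞, (A : Set B))
    (C : 𝒜 → Set B) (hC : ∀ A, (C A).Countable) (hCA : ∀ A, C A ⊆ (A.1 : Set B)) :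
    ∃ D : 𝒜, ∀ E : Set B, #E ≤ ℵ₁ → ∃ A : 𝒜, E ⊆ (A.1 : Set B) ∧ C A ⊆ (D.1 : Set B) := by
  by_contra! hcon
  choose E hE hEC using hcon
  -- Elements `n A` outside `A` make the chain strictly increasing, so that it has cofinality `ω₁`.
  have hout : ∀ A : 𝒜, ∃ b, b ∉ A.1 := by
    rintro ⟨A, hA⟩
    by_contra! hall
    refine hB.not_ge ((hcard A hA).symm ▸ ?_)
    exact mk_le_of_injective (f := fun b ↦ (⟨b, hall b⟩ : A)) fun a b h ↦ by simpa using h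
  choose n hn using hout
  let W := (ℵ₁ : Cardinal.{u}).ord.ToType
  have hcof : Order.cof W = ℵ₁ := by
    rw [Ordinal.cof_toType]; exact isRegular_aleph_one.cof_ord
  obtain ⟨F, hF⟩ := exists_forall_rel_iUnion (W := W)
    (fun w ↦ (mk_Iio_lt w (by simp [W])).le.trans_eq (mk_ord_toType _))
    (fun A : 𝒜 ↦ insert (n A) ((A.1 : Set B) ∪ E A))
    (fun A ↦ mk_insert_le.trans (add_le_of_le (aleph0_le_aleph 1)
      ((mk_union_le _ _).trans (add_le_of_le (aleph0_le_aleph 1) (hcard _ A.2).le (hE A)))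
      (one_le_aleph0.trans (aleph0_le_aleph 1))))
    (fun E A ↦ E ⊆ (A.1 : Set B)) (fun E hE ↦ by
      obtain ⟨A, hA, h⟩ := exists_mem_subset_of_card_le hB hcov E hE
      exact ⟨⟨A, hA⟩, h⟩)
  have hsub : ∀ v w, v < w → insert (n (F v)) (((F v).1 : Set B) ∪ E (F v)) ⊆ ((F w).1 : Set B) :=
    fun v w h ↦ (subset_iUnion
      (fun v : Iio w ↦ insert (n (F v)) (((F v).1 : Set B) ∪ E (F v))) ⟨v, h⟩).trans (hF w)
  have hmono : StrictMono fun w ↦ (F w).1 := fun v w h ↦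
    SetLike.lt_iff_le_and_exists.2 ⟨fun a ha ↦ hsub v w h (by simp [ha]),
      n (F v), hsub v w h (by simp), hn _⟩
  obtain ⟨D, hD, hDU⟩ := hchain (range fun w ↦ (F w).1) (by rintro _ ⟨w, rfl⟩; exact (F w).2)
    hmono.monotone.isChain_range (by rw [← hcof]; exact (hmono.orderIso _).symm.cof_congr)
  have hDU' : ∀ a, a ∈ D ↔ ∃ w, a ∈ (F w).1 := fun a ↦ by
    rw [← SetLike.mem_coe, hDU]; simp
  choose t ht using fun c : C ⟨D, hD⟩ ↦ (hDU' c).1 (hCA _ c.2)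
  -- Countably many stages are bounded in `ω₁`.
  have hbdd : ∃ z, ∀ c, t c ≤ z := by
    by_contra! hnb
    have h1 : Order.cof W ≤ #(range t) := Order.cof_le fun z ↦ by
      obtain ⟨c, hc⟩ := hnb z
      exact ⟨t c, ⟨c, rfl⟩, hc.le⟩
    rw [hcof] at h1
    have := (hC ⟨D, hD⟩).to_subtype
    exact (aleph0_lt_aleph_one.trans_le h1).not_ge (mk_le_aleph0_iff.2 (countable_range t))
  obtain ⟨z, hz⟩ := hbdd
  have hNoMax : ∃ z', z < z' := by
    by_contra! hmax
    have h1 : Order.cof W ≤ #({z} : Set W) := Order.cof_le fun y ↦ ⟨z, rfl, hmax y⟩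
    rw [hcof, mk_singleton] at h1
    exact h1.not_gt (one_lt_aleph0.trans aleph0_lt_aleph_one)
  obtain ⟨z', hz'⟩ := hNoMax
  refine hEC (F z) ⟨D, hD⟩ (fun e he ↦ (hDU' e).2 ⟨z', hsub z z' hz' (by simp [he])⟩) ?_
  exact fun c hc ↦ hmono.monotone (hz ⟨c, hc⟩) (ht ⟨c, hc⟩)

/-- Let `A` be an `ℵ₀`-ideal algebra of sets, `q` an ultrafilter extending the trace of `p` on `A`,
and let `b true ∈ p` and `b false ∈ q` be disjoint. The elements of `A` that are disjoint from
`b true` or from `b false` are dominated by countably many elements of `A`, none of them in `p`. -/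
theorem IsAleph0Ideal.exists_countable_cofinal {N : Type*} {A : BooleanSubalgebra (Set N)}
    (hA : IsAleph0Ideal A) {p q : Ultrafilter N} (hpq : ∀ a ∈ A, a ∈ p → a ∈ q)
    {b : Bool → Set N} (hb : Disjoint (b true) (b false)) (hp : b true ∈ p) (hq : b false ∈ q) :
    ∃ C : Set (Set N), C.Countable ∧ C ⊆ (A : Set (Set N)) ∧ (∀ c ∈ C, c ∉ p) ∧
      ∀ i, ∀ a ∈ A, Disjoint a (b i) → ∃ c ∈ C, a ⊆ c := by
  have hnp : ∀ i, ∀ c ∈ A, Disjoint c (b i) → c ∉ p := by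
    rintro (_ | _) c hc hcb hcp
    · exact q.empty_notMem (hcb.inter_eq ▸ inter_mem (hpq c hc hcp) hq)
    · exact p.empty_notMem (hcb.inter_eq ▸ inter_mem hcp hp)
  have hmem : ∀ i, (b i)ᶜ ∉ A := by
    rintro (_ | _) h
    · exact hnp false _ h disjoint_compl_left (mem_of_superset hp hb.subset_compl_right)
    · have h' : b true ∈ A := by simpa using h
      exact q.empty_notMem (hb.inter_eq ▸ inter_mem (hpq _ h' hp) hq)
  choose C hCA hC hCc using fun i ↦ hA _ (hmem i)
  refine ⟨⋃ i, C i, countable_iUnion hC, iUnion_subset fun i c hc ↦ (hCA i hc).1, ?_, ?_⟩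
  · intro c hc
    obtain ⟨i, hi⟩ := mem_iUnion.1 hc
    exact hnp i c (hCA i hi).1 (subset_compl_iff_disjoint_right.1 (hCA i hi).2.le)
  · intro i a ha hd
    obtain ⟨c, hc, hac⟩ := hCc i a ha (lt_of_le_of_ne (subset_compl_iff_disjoint_right.2 hd)
      (by rintro rfl; exact hmem i ha))
    exact ⟨c, mem_iUnion.2 ⟨i, hc⟩, hac⟩

/-- Induction on the largest index: `D` decides each step, since an element of `A w` disjoint from
`b w i` is covered by an element of `D` outside `p`. -/
theorem nonempty_inter_biInter {N W : Type*} [LinearOrder W] {p : Ultrafilter N}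
    {D : BooleanSubalgebra (Set N)} {A : W → BooleanSubalgebra (Set N)} {b : W → Bool → Set N}
    (hDA : ∀ w, D ≤ A w) (hbA : ∀ v w, v < w → ∀ i, b v i ∈ A w)
    (hgen : ∀ w i, ∀ a ∈ A w, Disjoint a (b w i) → ∃ c ∈ D, a ⊆ c ∧ c ∉ p)
    (ε : W → Bool) (s : Finset W) {d : Set N} (hd : d ∈ D) (hdp : d ∈ p) :
    (d ∩ ⋂ w ∈ s, b w (ε w)).Nonempty := by
  induction s using Finset.induction_on_max generalizing d with
  | empty => simpa using p.nonempty_of_mem hdp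
  | insert w s hs ih =>
    have hmem : ∀ t : Finset W, (∀ v ∈ t, v < w) → (⋂ v ∈ t, b v (ε v)) ∈ A w := by
      intro t
      induction t using Finset.induction_on with
      | empty => intro; simpa using (A w).top_mem
      | insert v t _ ih =>
        intro h
        rw [Finset.set_biInter_insert]
        exact (A w).inf_mem (hbA v w (h v (by simp)) _) (ih fun u hu ↦ h u (by simp [hu]))
    rw [Finset.set_biInter_insert, inter_left_comm, inter_comm, ← not_disjoint_iff_nonempty_inter]
    intro hdis
    obtain ⟨c, hc, hsub, hcp⟩ := hgen w _ _ ((A w).inf_mem (hDA w hd) (hmem s hs)) hdis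
    obtain ⟨n, ⟨hnd, hnc⟩, hns⟩ := ih (D.inf_mem hd (D.compl_mem hc))
      (inter_mem hdp (Ultrafilter.compl_mem_iff_notMem.2 hcp))
    exact hnc (hsub ⟨hnd, hns⟩)

/-! ### A point not determined by small algebras -/

/-- Each member is the range of a function from a set of size `ℵ₁` to the power set of `ℕ`, and
`(2 ^ ℵ₀) ^ ℵ₁ = 2 ^ ℵ₁`. -/
theorem mk_le_of_forall_mk_eq_aleph_one {𝒜 : Set (BooleanSubalgebra (Set ℕ))}
    (hcard : ∀ A ∈ 𝒜, #A = ℵ₁) : #𝒜 ≤ 2 ^ (ℵ₁ : Cardinal.{0}) := by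
  let W := (ℵ₁ : Cardinal.{0}).out
  have h : ∀ A : 𝒜, ∃ f : W → Set ℕ, range f = (A.1 : Set (Set ℕ)) := fun A ↦ by
    have : #W = #A.1 := by rw [hcard _ A.2, mk_out]
    obtain ⟨e⟩ := Cardinal.eq.1 this
    exact ⟨fun w ↦ e w, by rw [range_comp' Subtype.val e]; simp⟩
  choose f hf using h
  have hinj : Function.Injective f := fun A A' h ↦
    Subtype.ext (SetLike.coe_injective (by rw [← hf A, h, hf A']))
  refine (mk_le_of_injective hinj).trans ?_
  rw [← power_def, mk_out, mk_set, mk_nat, ← power_mul, aleph0_mul_aleph]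

/-- Some point `x` is the limit of `d` along an ultrafilter `p` whose trace on no `A ∈ 𝒜` suffices
for this convergence: the other points are determined by a member of `𝒜` and a subset of it. -/
theorem exists_tendsto_forall_not_determined {X : Type*} [TopologicalSpace X] [T2Space X]
    {d : ℕ → X} (hd : DenseRange d) {𝒜 : Set (BooleanSubalgebra (Set ℕ))}
    (hcard : ∀ A ∈ 𝒜, #A = ℵ₁) (hpow : (2 : Cardinal.{0}) ^ (ℵ₁ : Cardinal.{0}) = 𝔠)
    (hX : 𝔠 < #X) :
    ∃ (x : X) (p : Ultrafilter ℕ), Tendsto d p (𝓝 x) ∧ ∀ A ∈ 𝒜, ∃ q : Ultrafilter ℕ,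
      (∀ a ∈ A, a ∈ p → a ∈ q) ∧ ¬ Tendsto d q (𝓝 x) := by
  by_contra! hcon
  have hp : ∀ x : X, ∃ p : Ultrafilter ℕ, Tendsto d p (𝓝 x) := fun x ↦ by
    have : (comap d (𝓝 x)).NeBot := comap_neBot fun t ht ↦ hd.mem_nhds ht
    exact ⟨Ultrafilter.of _, tendsto_iff_comap.2 (Ultrafilter.of_le _)⟩
  choose p hp using hp
  choose A hA hq using fun x ↦ hcon x (p x) (hp x)
  let W := (ℵ₁ : Cardinal.{0}).out
  have he : ∀ A : 𝒜, Nonempty (A.1 ≃ W) := fun A ↦ by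
    rw [← Cardinal.eq, hcard _ A.2, mk_out]
  let e : ∀ A : 𝒜, A.1 ≃ W := fun A ↦ (he A).some
  -- All `A ∈ 𝒜` are identified with one type, so that traces on them become its subsets.
  let Φ : X → 𝒜 × Set W := fun x ↦
    (⟨A x, hA x⟩, {w | (((e ⟨A x, hA x⟩).symm w : A x) : Set ℕ) ∈ p x})
  have hΦ : Function.Injective Φ := by
    intro x y hxy
    obtain ⟨h1, h2⟩ := Prod.mk.inj hxy
    have htrace : ∀ a ∈ A x, a ∈ p x → a ∈ p y := by
      intro a ha hap
      have h3 := Set.ext_iff.1 h2 (e ⟨A x, hA x⟩ ⟨a, ha⟩)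
      rw [← h1] at h3
      simpa [hap] using h3
    exact tendsto_nhds_unique (hq x (p y) htrace) (hp y)
  have hle : #(𝒜 × Set W) ≤ 𝔠 := by
    rw [mk_prod, lift_id, lift_id, mk_set, mk_out, hpow]
    exact mul_le_of_le aleph0_le_continuum
      ((mk_le_of_forall_mk_eq_aleph_one hcard).trans_eq hpow) le_rfl
  have h := (lift_mk_le_lift_mk_of_injective hΦ).trans (lift_le.2 hle)
  exact hX.not_ge (by simpa using h)

/-! ### Dyadic families -/

/-- A dyadic family of continuous functions indexed by `ι × ℕ` gives a continuous surjection onto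
the cube `ι → I`: it maps a closed subset of `X` onto a Cantor cube, and hence onto `ι → I`. -/
theorem exists_continuous_surjective_of_dyadic {X ι : Type*} [TopologicalSpace X] [CompactSpace X]
    [T2Space X] (g : ι × ℕ → C(X, ℝ))
    (hg : ∀ (s : Finset (ι × ℕ)) (ε : ι × ℕ → Bool),
      ∃ x, ∀ k ∈ s, if ε k then 2 / 3 ≤ g k x else g k x ≤ 1 / 3) :
    ∃ f : X → (ι → unitInterval), Continuous f ∧ Function.Surjective f := by
  let K : Set X := {x | ∀ k, g k x ≤ 1 / 3 ∨ 2 / 3 ≤ g k x}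
  have hK : IsClosed K := by
    simp only [K, ofPred_forall, ofPred_or]
    exact isClosed_iInter fun k ↦ (isClosed_le (by fun_prop) (by fun_prop)).union
      (isClosed_le (by fun_prop) (by fun_prop))
  let h : K → ι → ℕ → Bool := fun x i n ↦ decide (1 / 2 < g (i, n) x)
  -- On `K` no value of `g k` lies strictly between `1 / 3` and `2 / 3`.
  have hh : Continuous h := by
    refine continuous_pi fun i ↦ continuous_pi fun n ↦ ?_
    have hclopen : IsClopen {x : K | 1 / 2 < g (i, n) x} := by
      refine ⟨?_, isOpen_lt (by fun_prop) (by fun_prop)⟩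
      have : {x : K | 1 / 2 < g (i, n) x} = {x : K | 2 / 3 ≤ g (i, n) x} := by
        ext x
        have := x.2 (i, n)
        simp only [mem_ofPred_eq]
        constructor
        · intro hx; rcases this with h | h <;> linarith
        · intro hx; linarith
      rw [this]
      exact isClosed_le (by fun_prop) (by fun_prop)
    refine (continuous_bool_rng true).2 ?_
    convert hclopen using 1
    ext x
    simp [h]
  have hsurj : Function.Surjective h := by
    intro ε
    obtain ⟨x, hx⟩ := CompactSpace.iInter_nonempty
      (t := fun k : ι × ℕ ↦ {x | if ε k.1 k.2 then 2 / 3 ≤ g k x else g k x ≤ 1 / 3})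
      (fun k ↦ by
        cases ε k.1 k.2
        · simpa using isClosed_le (by fun_prop) (by fun_prop)
        · simpa using isClosed_le (by fun_prop) (by fun_prop))
      (fun s ↦ by
        obtain ⟨x, hx⟩ := hg s fun k ↦ ε k.1 k.2
        exact ⟨x, by simpa using hx⟩)
    have hx' : ∀ k : ι × ℕ, if ε k.1 k.2 then 2 / 3 ≤ g k x else g k x ≤ 1 / 3 := by
      simpa only [mem_iInter, mem_ofPred_eq] using hx
    refine ⟨⟨x, fun k ↦ ?_⟩, ?_⟩
    · have := hx' k
      split_ifs at this
      · exact .inr this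
      · exact .inl this
    · ext i n
      have := hx' (i, n)
      cases hε : ε i n
      · simp only [hε, Bool.false_eq_true, if_false] at this
        simp only [h, decide_eq_false_iff_not]
        linarith
      · simp only [hε, if_true] at this
        simp only [h, decide_eq_true_eq]
        linarith
  obtain ⟨φ, hφ, hφs⟩ := exists_nat_bool_continuous_surjective_of_compact unitInterval
  let F : C(K, ι → unitInterval) := ⟨fun x i ↦ φ (h x i), by fun_prop⟩
  obtain ⟨f, hf⟩ := ContinuousMap.exists_restrict_eq hK F
  refine ⟨f, f.continuous, fun y ↦ ?_⟩
  choose e he using fun i ↦ hφs (y i)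
  obtain ⟨x, hx⟩ := hsurj e
  refine ⟨x, ?_⟩
  have := DFunLike.congr_fun hf x
  simp only [ContinuousMap.restrict_apply] at this
  rw [this]
  ext i
  simp [F, hx, he]

theorem mainTheorem8
    (hideal : IsAleph1Aleph0Ideal (Set ℕ))
    (hpow : (2 : Cardinal.{0}) ^ (ℵ₁ : Cardinal.{0}) = 𝔠)
    (hcont : (𝔠 : Cardinal.{0}) = ℵ_ 2)
    {X : Type*} [TopologicalSpace X] [CompactSpace X] [T2Space X]
    [TopologicalSpace.SeparableSpace X] (hX : 𝔠 < #X)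
    {ι : Type*} (hι : #ι = 𝔠) :
    ∃ f : X → (ι → unitInterval), Continuous f ∧ Function.Surjective f := by
  obtain ⟨𝒜, h𝒜, hcov, hchain⟩ := hideal
  have hcard : ∀ A ∈ 𝒜, #A = ℵ₁ := fun A hA ↦ (h𝒜 A hA).1
  have hB : ℵ₁ < #(Set ℕ) := by
    rw [mk_set, mk_nat, two_power_aleph0, hcont]
    exact aleph_lt_aleph.2 (by norm_num)
  have : Nonempty X := mk_ne_zero_iff.1 (ne_bot_of_gt hX)
  let d := TopologicalSpace.denseSeq X
  obtain ⟨x, p, hpx, hq⟩ := exists_tendsto_forall_not_determined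
    (TopologicalSpace.denseRange_denseSeq X) hcard hpow hX
  -- Urysohn's lemma separates `x` from the limit of `d` along an ultrafilter that has the same
  -- trace on `A` as `p` but does not converge to `x`.
  have hsep : ∀ A : 𝒜, ∃ (q : Ultrafilter ℕ) (g : C(X, ℝ)), (∀ a ∈ A.1, a ∈ p → a ∈ q) ∧
      {n | 2 / 3 ≤ g (d n)} ∈ p ∧ {n | g (d n) ≤ 1 / 3} ∈ q := fun A ↦ by
    obtain ⟨q, hpq, hqx⟩ := hq A A.2
    have hy : Tendsto d q (𝓝 (q.map d).lim) := Ultrafilter.le_nhds_lim (q.map d)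
    have hne : (q.map d).lim ≠ x := fun h ↦ hqx (h ▸ hy)
    obtain ⟨g, hg0, hg1, -⟩ := exists_continuous_zero_one_of_isClosed
      (isClosed_singleton (x := (q.map d).lim)) (isClosed_singleton (x := x)) (by simpa using hne)
    refine ⟨q, g, hpq, ?_, ?_⟩
    · have := (g.continuous.tendsto x).comp hpx
      rw [hg1 rfl] at this
      filter_upwards [this.eventually (lt_mem_nhds (show (2 / 3 : ℝ) < 1 by norm_num))] with n hn
      exact hn.le
    · have := (g.continuous.tendsto _).comp hy
      rw [hg0 rfl] at this
      filter_upwards [this.eventually (gt_mem_nhds (show (0 : ℝ) < 1 / 3 by norm_num))] with n hn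
      exact hn.le
  choose q g hpq hgp hgq using hsep
  let b : 𝒜 → Bool → Set ℕ := fun A i ↦ {n | if i then 2 / 3 ≤ g A (d n) else g A (d n) ≤ 1 / 3}
  choose C hC hCA hCp hCc using fun A : 𝒜 ↦
    (h𝒜 A A.2).2.exists_countable_cofinal (b := b A) (hpq A)
      (Set.disjoint_left.2 fun n h1 h2 ↦ by simp [b] at h1 h2; linarith)
      (by simpa [b] using hgp A) (by simpa [b] using hgq A)
  obtain ⟨D, hD⟩ := exists_mem_forall_exists_subset hB hcard hcov hchain C hC hCA
  let W := (ℵ_ 2 : Cardinal.{0}).ord.ToType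
  have hW : ∀ w : W, #(Iio w) ≤ ℵ₁ := fun w ↦ by
    have h : #(Iio w) < ℵ_ 2 := (mk_Iio_lt w (by simp [W])).trans_eq (mk_ord_toType _)
    exact Order.lt_succ_iff.1 (h.trans_eq (by rw [succ_aleph, one_add_one_eq_two]))
  -- The `w`-th algebra contains `D` and the sets attached to all earlier algebras, and its
  -- countable cofinal sets lie in `D`.
  obtain ⟨A, hA⟩ := exists_forall_rel_iUnion hW (fun A ↦ range (b A))
    (fun A ↦ (mk_le_aleph0_iff.2 inferInstance).trans (aleph0_le_aleph 1))
    (fun E A ↦ (D.1 : Set (Set ℕ)) ∪ E ⊆ A.1 ∧ C A ⊆ (D.1 : Set (Set ℕ)))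
    (fun E hE ↦ hD _ ((mk_union_le _ _).trans
      (add_le_of_le (aleph0_le_aleph 1) (hcard _ D.2).le hE)))
  have hW𝔠 : Nonempty (ι × ℕ ≃ W) := by
    refine lift_mk_eq'.1 ?_
    simp [W, hι, ← hcont]
  obtain ⟨e⟩ := hW𝔠
  refine exists_continuous_surjective_of_dyadic (fun k ↦ g (A (e k))) fun s ε ↦ ?_
  -- Independence of the sets `b (A w)` is inherited by the functions, at the points `d n`.
  obtain ⟨n, -, hn⟩ := nonempty_inter_biInter (p := p) (D := D.1) (A := fun w ↦ (A w).1)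
    (b := fun w ↦ b (A w)) (fun w ↦ subset_union_left.trans (hA w).1)
    (fun v w hvw i ↦ (hA w).1 (.inr (mem_iUnion.2 ⟨⟨v, hvw⟩, i, rfl⟩)))
    (fun w i a ha hdis ↦ by
      obtain ⟨c, hc, hac⟩ := hCc (A w) i a ha hdis
      exact ⟨c, (hA w).2 hc, hac, hCp _ c hc⟩)
    (ε ∘ e.symm) (s.map e.toEmbedding) D.1.top_mem univ_mem
  exact ⟨d n, fun k hk ↦ by simpa [b] using mem_iInter₂.1 hn (e k) (by simpa using hk)⟩
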